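/- \textbf{Setting.} Let $\mu$ be a $\sigma$-finite measure on a measurable space $Z$, $\Theta\subseteq\mathbb R^l$, $\mathcal S\subseteq\mathbb R^q$, $S:Z\to\mathcal S$ measurable, $\psi:\Theta\to\mathbb R$, $\phi:\Theta\to\mathbb R^q$, and put $$L(s;\theta)=\psi(\theta)+\langle s,\phi(\theta)\rangle,\quad h(z;\theta)=e^{L(S(z);\theta)},\quad f(\theta)=\int h(z;\theta)\,\mu(dz),\quad p_\theta(z)=\frac{h(z;\theta)}{f(\theta)},\quad \bar S(\theta)=\int S\,p_\theta\,d\mu .$$ (\textbf{M1}) is this setting. (\textbf{M2}) (a) $\psi,\phi$ are continuous on $\Theta$; (b) for all $\theta\in\Theta$ the integral $\bar S(\theta)$ converges absolutely, $\bar S(\theta)\in\mathcal S$, and $\bar S$ is continuous on $\Theta$; (c) $\hat\theta:\mathcal S\to\Theta$ is a continuous function with $L(s;\hat\theta(s))=\sup_{\theta\in\Theta}L(s;\theta)$ for all $s\in\mathcal S$; (d) $f$ is positive, finite and continuous on $\Theta$, and $\{\theta\in\Theta: f(\theta)\ge c\}$ is compact for every $c>0$. Let $T=\hat\theta\circ\bar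 S$ be the EM map. Let $\mathcal L$ be either the set $\{\theta\in\Theta:T(\theta)=\theta\}$ of stationary points of EM or, if $\Theta$ is open and $\psi,\phi,f$ are differentiable on $\Theta$, the set $\{\theta\in\Theta:\nabla f(\theta)=0\}$ of critical points of $f$ (the theorem holds for each of the two choices). (\textbf{M3}) Either $f(\mathcal L)$ is compact, or $f(\mathcal L\cap K)$ is finite for every compact $K\subseteq\Theta$. \textbf{Algorithm.} For $n\in\mathbb N$ and $\theta\in\Theta$ let $\tilde p_{\theta,n}:Z\to\mathbb R$ be a (deterministic) measurable function such that $\tilde S_n(\theta)=\int S\,\tilde p_{\theta,n}\,d\mu$ converges absolutely and lies in $\mathcal S$, and put $F_n(\theta)=\hat\theta(\tilde S_n(\theta))$. Let $(K_n)_{n\ge0}$ be an increasing sequence of compact sets with $\bigcup_nK_n=\Theta$ such that every compact subset of $\Theta$ is contained in some $K_n$, and let $\theta_0\in K_0$. The stable approximate EM sequence starts from $\theta_0$ and $p_0=0$; if $F_n(\theta_n)\in K_{p_n}$, then $\theta_{n+1}=F_n(\theta_n)$ and $p_{n+1}=p_n$; otherwise it is reinitialised, $\theta_{n+1}=\theta_0$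 and $p_{n+1}=p_n+1$. \textbf{Theorem.} Assume M1--M3, and that for every $u\in\{1,\dots,q\}$ and every compact $K\subseteq\Theta$ one of the following holds: $$\int S_u^2\,d\mu<\infty\quad\text{and}\quad\sup_{\theta\in K}\int(\tilde p_{\theta,n}-p_\theta)^2\,d\mu\xrightarrow[n\to\infty]{}0,$$ $$\text{or}\quad\sup_{\theta\in K}\int S_u^2\,p_\theta\,d\mu<\infty\quad\text{and}\quad\sup_{\theta\in K}\int\Big(\frac{\tilde p_{\theta,n}}{p_\theta}-1\Big)^2p_\theta\,d\mu\xrightarrow[n\to\infty]{}0.$$ Then, with $\mathrm{Cl}$ the closure of $\{\theta_n:n\in\mathbb N\}$: (i)(a) $(p_n)$ is bounded and $(\theta_n)$ stays in a compact subset of $\Theta$; (i)(b) there is a connected component $C$ of $f(\mathcal L\cap\mathrm{Cl})$ with $\mathrm{dist}(f(\theta_n),C)\to0$; in particular $f(\mathcal L\cap\mathrm{Cl})$ is non-empty; (ii) if $f(\mathcal L\cap\mathrm{Cl})$ has empty interior, then there is $f^*\in\mathbb R$ with $f(\theta_n)\to f^*$, and with $\mathcal L_{f^*}=\{\theta\in\mathcal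 L:f(\theta)=f^*\}$ the set $\mathcal L_{f^*}\cap\mathrm{Cl}$ is non-empty and $\mathrm{dist}(\theta_n,\mathcal L_{f^*}\cap\mathrm{Cl})\to0$. -/

import Mathlib

open Filter Topology MeasureTheory Set
open scoped ENNReal

/-- A curved exponential family, seen from the fixed observation: parameter set `Θ ⊆ ℝˡ`, set of
statistics `𝒮 ⊆ ℝ^q`, a sufficient statistic `S` of the hidden variable with values in `𝒮`, and the
functions `ψ : Θ → ℝ` and `φ : Θ → ℝ^q` (only their restrictions to `Θ` matter). -/
structure CurvedExpFamily (Z : Type*) [MeasurableSpace Z] (l q : ℕ) where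
  /-- the parameter set -/
  Θ : Set (EuclideanSpace ℝ (Fin l))
  /-- the set of statistics -/
  𝒮 : Set (EuclideanSpace ℝ (Fin q))
  /-- the scalar part of the log-density -/
  ψ : EuclideanSpace ℝ (Fin l) → ℝ
  /-- the natural parameter -/
  φ : EuclideanSpace ℝ (Fin l) → EuclideanSpace ℝ (Fin q)
  /-- the sufficient statistic -/
  S : Z → EuclideanSpace ℝ (Fin q)
  measurable_S : Measurable S
  S_mem : ∀ z, S z ∈ 𝒮

namespace CurvedExpFamily

variable {Z : Type*} [MeasurableSpace Z] {l q : ℕ}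

/-- `L(s; θ) = ψ(θ) + ⟨s, φ(θ)⟩`. -/
noncomputable def L (M : CurvedExpFamily Z l q) (s : EuclideanSpace ℝ (Fin q))
    (θ : EuclideanSpace ℝ (Fin l)) : ℝ :=
  M.ψ θ + inner ℝ s (M.φ θ)

/-- The complete likelihood `h(z; θ) = exp L(S(z); θ)`. -/
noncomputable def h (M : CurvedExpFamily Z l q) (θ : EuclideanSpace ℝ (Fin l)) (z : Z) : ℝ :=
  Real.exp (M.L (M.S z) θ)

/-- The (observed) likelihood `f(θ) = ∫ h(z; θ) μ(dz)`. -/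
noncomputable def f (M : CurvedExpFamily Z l q) (μ : Measure Z)
    (θ : EuclideanSpace ℝ (Fin l)) : ℝ :=
  ∫ z, M.h θ z ∂μ

/-- The conditional density of the hidden variable `p_θ(z) = h(z; θ) / f(θ)`. -/
noncomputable def p (M : CurvedExpFamily Z l q) (μ : Measure Z)
    (θ : EuclideanSpace ℝ (Fin l)) (z : Z) : ℝ :=
  M.h θ z / M.f μ θ

/-- The exact E-step `S̄(θ) = ∫ S(z) p_θ(z) μ(dz)`. -/
noncomputable def Sbar (M : CurvedExpFamily Z l q) (μ : Measure Z)
    (θ : EuclideanSpace ℝ (Fin l)) : EuclideanSpace ℝ (Fin q) :=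
  ∫ z, M.p μ θ z • M.S z ∂μ

/-- An E-step `∫ S(z) r(z) μ(dz)` made with a function `r` in place of the conditional density. -/
noncomputable def Stilde (M : CurvedExpFamily Z l q) (μ : Measure Z) (r : Z → ℝ) :
    EuclideanSpace ℝ (Fin q) :=
  ∫ z, r z • M.S z ∂μ

/-- Regularity of the model; `θhat` is the M-step. -/
structure M2 (M : CurvedExpFamily Z l q) (μ : Measure Z)
    (θhat : EuclideanSpace ℝ (Fin q) → EuclideanSpace ℝ (Fin l)) : Prop where
  continuousOn_ψ : ContinuousOn M.ψ M.Θ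
  continuousOn_φ : ContinuousOn M.φ M.Θ
  integrable_S : ∀ θ ∈ M.Θ, Integrable (fun z => M.p μ θ z • M.S z) μ
  Sbar_mem : ∀ θ ∈ M.Θ, M.Sbar μ θ ∈ M.𝒮
  continuousOn_Sbar : ContinuousOn (M.Sbar μ) M.Θ
  continuousOn_θhat : ContinuousOn θhat M.𝒮
  θhat_mem : ∀ s ∈ M.𝒮, θhat s ∈ M.Θ
  θhat_max : ∀ s ∈ M.𝒮, ∀ θ ∈ M.Θ, M.L s θ ≤ M.L s (θhat s)
  f_finite : ∀ θ ∈ M.Θ, Integrable (M.h θ) μ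
  f_pos : ∀ θ ∈ M.Θ, 0 < M.f μ θ
  continuousOn_f : ContinuousOn (M.f μ) M.Θ
  isCompact_level : ∀ c : ℝ, 0 < c → IsCompact {θ ∈ M.Θ | c ≤ M.f μ θ}

/-- The exact EM map `T = θ̂ ∘ S̄`. -/
noncomputable def T (M : CurvedExpFamily Z l q) (μ : Measure Z)
    (θhat : EuclideanSpace ℝ (Fin q) → EuclideanSpace ℝ (Fin l))
    (θ : EuclideanSpace ℝ (Fin l)) : EuclideanSpace ℝ (Fin l) :=
  θhat (M.Sbar μ θ)

/-- The stationary points of the exact EM. -/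
def stationarySet (M : CurvedExpFamily Z l q) (μ : Measure Z)
    (θhat : EuclideanSpace ℝ (Fin q) → EuclideanSpace ℝ (Fin l)) :
    Set (EuclideanSpace ℝ (Fin l)) :=
  {θ ∈ M.Θ | M.T μ θhat θ = θ}

/-- The critical points of the likelihood, `∇f(θ) = 0`. -/
def criticalSet (M : CurvedExpFamily Z l q) (μ : Measure Z) :
    Set (EuclideanSpace ℝ (Fin l)) :=
  {θ ∈ M.Θ | HasGradientAt (M.f μ) 0 θ}

/-- The setting in which `∇f` makes sense: `Θ` is open and `ψ`, `φ`, `f` are differentiable. -/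
structure Smooth (M : CurvedExpFamily Z l q) (μ : Measure Z) : Prop where
  isOpen_Θ : IsOpen M.Θ
  differentiableOn_ψ : DifferentiableOn ℝ M.ψ M.Θ
  differentiableOn_φ : DifferentiableOn ℝ M.φ M.Θ
  differentiableOn_f : DifferentiableOn ℝ (M.f μ) M.Θ

/-- The condition on the likelihood values at the points of `ℒ`. -/
def M3 (M : CurvedExpFamily Z l q) (μ : Measure Z) (ℒ : Set (EuclideanSpace ℝ (Fin l))) : Prop :=
  IsCompact (M.f μ '' ℒ) ∨ ∀ K ⊆ M.Θ, IsCompact K → (M.f μ '' (ℒ ∩ K)).Finite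

/-- The approximations `ptilde n θ` of the densities `p_θ` give a well defined E-step in `𝒮`. -/
structure WellDefinedEStep (M : CurvedExpFamily Z l q) (μ : Measure Z)
    (ptilde : ℕ → EuclideanSpace ℝ (Fin l) → Z → ℝ) : Prop where
  measurable : ∀ n, ∀ θ ∈ M.Θ, Measurable (ptilde n θ)
  integrable : ∀ n, ∀ θ ∈ M.Θ, Integrable (fun z => ptilde n θ z • M.S z) μ
  mem : ∀ n, ∀ θ ∈ M.Θ, M.Stilde μ (ptilde n θ) ∈ M.𝒮

/-- First configuration: `∫ S_u² < ∞` and `sup_{θ ∈ K} ∫ (p̃_{θ,n} - p_θ)² → 0`. -/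
def ApproxL2 (M : CurvedExpFamily Z l q) (μ : Measure Z)
    (ptilde : ℕ → EuclideanSpace ℝ (Fin l) → Z → ℝ)
    (K : Set (EuclideanSpace ℝ (Fin l))) (u : Fin q) : Prop :=
  (∫⁻ z, ENNReal.ofReal (M.S z u ^ 2) ∂μ) < ∞ ∧
  Tendsto (fun n => ⨆ θ ∈ K, ∫⁻ z, ENNReal.ofReal ((ptilde n θ z - M.p μ θ z) ^ 2) ∂μ)
    atTop (𝓝 0)

/-- Second configuration: `sup_{θ ∈ K} ∫ S_u² p_θ < ∞` and
`sup_{θ ∈ K} ∫ (p̃_{θ,n} / p_θ - 1)² p_θ → 0`. -/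
def ApproxChiSq (M : CurvedExpFamily Z l q) (μ : Measure Z)
    (ptilde : ℕ → EuclideanSpace ℝ (Fin l) → Z → ℝ)
    (K : Set (EuclideanSpace ℝ (Fin l))) (u : Fin q) : Prop :=
  (⨆ θ ∈ K, ∫⁻ z, ENNReal.ofReal (M.S z u ^ 2 * M.p μ θ z) ∂μ) < ∞ ∧
  Tendsto (fun n => ⨆ θ ∈ K,
      ∫⁻ z, ENNReal.ofReal ((ptilde n θ z / M.p μ θ z - 1) ^ 2 * M.p μ θ z) ∂μ)
    atTop (𝓝 0)

/-- The approximate EM map `F_n(θ) = θ̂(S̃_n(θ))`, with `S̃_n(θ) = ∫ S(z) p̃_{θ,n}(z) μ(dz)`. -/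
noncomputable def approxMap (M : CurvedExpFamily Z l q) (μ : Measure Z)
    (θhat : EuclideanSpace ℝ (Fin q) → EuclideanSpace ℝ (Fin l))
    (ptilde : ℕ → EuclideanSpace ℝ (Fin l) → Z → ℝ)
    (n : ℕ) (θ : EuclideanSpace ℝ (Fin l)) : EuclideanSpace ℝ (Fin l) :=
  θhat (M.Stilde μ (ptilde n θ))

end CurvedExpFamily

open Classical in
/-- The stable (truncated) iteration of maps `F n` along the sets `K 0 ⊆ K 1 ⊆ ⋯`; the value at `n`
is the pair `(θ_n, p_n)`. If `F_n(θ_n) ∈ K_{p_n}` then `θ_{n+1} = F_n(θ_n)` and `p_{n+1} = p_n`;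
otherwise the iteration is reinitialised: `θ_{n+1} = θ_0` and `p_{n+1} = p_n + 1`. -/
noncomputable def stableIter {E : Type*} (F : ℕ → E → E) (K : ℕ → Set E) (θ₀ : E) : ℕ → E × ℕ
  | 0 => (θ₀, 0)
  | n + 1 =>
    let x := stableIter F K θ₀ n
    if F n x.1 ∈ K x.2 then (F n x.1, x.2) else (θ₀, x.2 + 1)

/-- An increasing sequence of compact subsets of `Θ` that covers `Θ` and swallows every compact
subset of `Θ`. -/
structure IsTruncationSeq {E : Type*} [TopologicalSpace E] (Θ : Set E) (K : ℕ → Set E) :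
    Prop where
  isCompact : ∀ n, IsCompact (K n)
  mono : Monotone K
  iUnion_eq : ⋃ n, K n = Θ
  absorbs : ∀ C ⊆ Θ, IsCompact C → ∃ n, C ⊆ K n

/-! The likelihood `f` is a Lyapunov function for `T`. Tilting `p_θ` towards `θ'` and integrating
`e^u ≥ 1 + u`, with `u` the centred log-ratio, gives the minorization `M2.mul_exp_le_f`; the M-step
makes its exponent nonnegative. If `f (T θ) = f θ`, then `u = 0` almost everywhere, so `θ` and `T θ`
share an E-step and `T θ` is a fixed point.

Cauchy–Schwarz turns either approximation hypothesis into uniform convergence of the E-steps, hence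
of the approximate maps to `T`, on compact sets. By M3 some level `0 < c ≤ f θ₀` is missed by `f ''
ℒ`; `T` pushes the compact set `{f ≥ c}` into `{f > c}` with a uniform margin, so late approximate
maps preserve it and restarts cease (`stableIter_bddAbove`).

The sequence then lives in a compact set, and every limit `y` of a subsequence has `T y` as limit of
the successors. A value `c` crossed downwards infinitely often satisfies `c ≤ f y ≤ f (T y) ≤ c`, so
it is attained in `ℒ`. Hence the values converge, or `f` of the accumulation points in `ℒ` fills an
interval. -/

namespace CurvedExpFamily

/-! ### Minorization of the likelihood and its equality case. -/

section Jensen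

variable {Z : Type*} [MeasurableSpace Z] {l q : ℕ} {μ : Measure Z} {M : CurvedExpFamily Z l q}
  {θhat : EuclideanSpace ℝ (Fin q) → EuclideanSpace ℝ (Fin l)}

theorem h_pos (θ : EuclideanSpace ℝ (Fin l)) (z : Z) : 0 < M.h θ z := Real.exp_pos _

theorem measurable_h (θ : EuclideanSpace ℝ (Fin l)) : Measurable (M.h θ) := by
  unfold h L
  exact Real.measurable_exp.comp
    (measurable_const.add (M.measurable_S.inner measurable_const))

theorem measurable_p (θ : EuclideanSpace ℝ (Fin l)) : Measurable (M.p μ θ) :=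
  (measurable_h θ).div_const _

theorem M2.p_pos (hM : M.M2 μ θhat) {θ : EuclideanSpace ℝ (Fin l)} (hθ : θ ∈ M.Θ) (z : Z) :
    0 < M.p μ θ z := div_pos (h_pos θ z) (hM.f_pos θ hθ)

theorem M2.integrable_p (hM : M.M2 μ θhat) {θ : EuclideanSpace ℝ (Fin l)} (hθ : θ ∈ M.Θ) :
    Integrable (M.p μ θ) μ := (hM.f_finite θ hθ).div_const _

theorem M2.integral_p (hM : M.M2 μ θhat) {θ : EuclideanSpace ℝ (Fin l)} (hθ : θ ∈ M.Θ) :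
    ∫ z, M.p μ θ z ∂μ = 1 := by
  unfold p
  rw [integral_div]
  exact div_self (hM.f_pos θ hθ).ne'

theorem M2.integrable_inner (hM : M.M2 μ θhat) {θ : EuclideanSpace ℝ (Fin l)} (hθ : θ ∈ M.Θ)
    (v : EuclideanSpace ℝ (Fin q)) :
    Integrable (fun z => M.p μ θ z * inner ℝ (M.S z) v) μ := by
  simpa [real_inner_smul_left] using (hM.integrable_S θ hθ).inner_const (𝕜 := ℝ) v

theorem M2.integral_inner (hM : M.M2 μ θhat) {θ : EuclideanSpace ℝ (Fin l)} (hθ : θ ∈ M.Θ)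
    (v : EuclideanSpace ℝ (Fin q)) :
    ∫ z, M.p μ θ z * inner ℝ (M.S z) v ∂μ = inner ℝ (M.Sbar μ θ) v := by
  have h1 := _root_.integral_inner (𝕜 := ℝ) (hM.integrable_S θ hθ) v
  simp only [real_inner_smul_right] at h1
  rw [Sbar, real_inner_comm, ← h1]
  simp only [real_inner_comm]

/-- The log-likelihood ratio of the complete data, centred at its conditional mean. -/
noncomputable def centredRatio (M : CurvedExpFamily Z l q) (μ : Measure Z)
    (θ θ' : EuclideanSpace ℝ (Fin l)) (z : Z) : ℝ :=
  inner ℝ (M.S z) (M.φ θ' - M.φ θ) - inner ℝ (M.Sbar μ θ) (M.φ θ' - M.φ θ)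

/-- Exponential tilting stays in the family: the terms in `ψ` and the centring do not depend on `z`
and go into the denominator. -/
theorem M2.p_mul_exp_centredRatio (hM : M.M2 μ θhat) {θ θ' : EuclideanSpace ℝ (Fin l)}
    (hθ : θ ∈ M.Θ) (z : Z) :
    M.p μ θ z * Real.exp (M.centredRatio μ θ θ' z) =
      M.h θ' z / (M.f μ θ * Real.exp (M.L (M.Sbar μ θ) θ' - M.L (M.Sbar μ θ) θ)) := by
  have hf := (hM.f_pos θ hθ).ne'
  rw [eq_div_iff (mul_ne_zero hf (Real.exp_ne_zero _)), p, h, h]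
  field_simp
  rw [← Real.exp_add, ← Real.exp_add]
  congr 1
  simp only [centredRatio, L, inner_sub_right]
  ring

/-- Centring makes the linear term integrate to zero, so the integral is exactly the relative defect
in the minorization. -/
theorem M2.integrable_gap (hM : M.M2 μ θhat) {θ θ' : EuclideanSpace ℝ (Fin l)}
    (hθ : θ ∈ M.Θ) (hθ' : θ' ∈ M.Θ) :
    Integrable (fun z => M.p μ θ z *
      (Real.exp (M.centredRatio μ θ θ' z) - (M.centredRatio μ θ θ' z + 1))) μ ∧
    ∫ z, M.p μ θ z *
      (Real.exp (M.centredRatio μ θ θ' z) - (M.centredRatio μ θ θ' z + 1)) ∂μ =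
      M.f μ θ' / (M.f μ θ * Real.exp (M.L (M.Sbar μ θ) θ' - M.L (M.Sbar μ θ) θ)) - 1 := by
  set c := M.f μ θ * Real.exp (M.L (M.Sbar μ θ) θ' - M.L (M.Sbar μ θ) θ)
  set m := inner ℝ (M.Sbar μ θ) (M.φ θ' - M.φ θ) with hm
  have h1 : Integrable (fun z => M.h θ' z / c) μ := (hM.f_finite θ' hθ').div_const _
  have h2 := hM.integrable_inner hθ (M.φ θ' - M.φ θ)
  have h3 : Integrable (fun z => M.p μ θ z * (1 - m)) μ := (hM.integrable_p hθ).mul_const _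
  have key : (fun z => M.p μ θ z *
      (Real.exp (M.centredRatio μ θ θ' z) - (M.centredRatio μ θ θ' z + 1))) =
      fun z => M.h θ' z / c - (M.p μ θ z * inner ℝ (M.S z) (M.φ θ' - M.φ θ)
        + M.p μ θ z * (1 - m)) := by
    funext z
    rw [mul_sub, hM.p_mul_exp_centredRatio hθ, centredRatio]
    ring
  rw [key]
  refine ⟨h1.sub (h2.add h3), ?_⟩
  rw [integral_sub h1 (by exact h2.add h3), integral_add h2 h3, integral_div, integral_mul_const,
    hM.integral_p hθ, hM.integral_inner hθ, ← hm, ← f]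
  ring

theorem M2.gap_nonneg (hM : M.M2 μ θhat) {θ θ' : EuclideanSpace ℝ (Fin l)} (hθ : θ ∈ M.Θ) :
    0 ≤ fun z => M.p μ θ z *
      (Real.exp (M.centredRatio μ θ θ' z) - (M.centredRatio μ θ θ' z + 1)) :=
  fun z => mul_nonneg (hM.p_pos hθ z).le (sub_nonneg.2 (Real.add_one_le_exp _))

/-- The minorization of the likelihood on which EM rests. -/
theorem M2.mul_exp_le_f (hM : M.M2 μ θhat) {θ θ' : EuclideanSpace ℝ (Fin l)}
    (hθ : θ ∈ M.Θ) (hθ' : θ' ∈ M.Θ) :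
    M.f μ θ * Real.exp (M.L (M.Sbar μ θ) θ' - M.L (M.Sbar μ θ) θ) ≤ M.f μ θ' := by
  have h0 := integral_nonneg (μ := μ) (hM.gap_nonneg (θ' := θ') hθ)
  rw [(hM.integrable_gap hθ hθ').2, sub_nonneg, le_div_iff₀, one_mul] at h0
  · exact h0
  · exact mul_pos (hM.f_pos θ hθ) (Real.exp_pos _)

/-- Equality in the minorization forces the conditional densities to agree. -/
theorem M2.Sbar_eq_of_f_eq (hM : M.M2 μ θhat) {θ θ' : EuclideanSpace ℝ (Fin l)}
    (hθ : θ ∈ M.Θ) (hθ' : θ' ∈ M.Θ)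
    (hL : M.L (M.Sbar μ θ) θ ≤ M.L (M.Sbar μ θ) θ') (hf : M.f μ θ' = M.f μ θ) :
    M.Sbar μ θ' = M.Sbar μ θ := by
  have hpos := hM.f_pos θ hθ
  have h1 := hM.mul_exp_le_f hθ hθ'
  have h2 : Real.exp (M.L (M.Sbar μ θ) θ' - M.L (M.Sbar μ θ) θ) ≤ 1 := by
    rw [hf] at h1
    exact le_of_mul_le_mul_left (by simpa using h1) hpos
  have h3 : M.L (M.Sbar μ θ) θ' - M.L (M.Sbar μ θ) θ = 0 :=
    le_antisymm (Real.exp_le_one_iff.1 h2) (sub_nonneg.2 hL)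
  obtain ⟨hi, he⟩ := hM.integrable_gap hθ hθ'
  rw [h3, Real.exp_zero, mul_one, hf, div_self hpos.ne', sub_self,
    integral_eq_zero_iff_of_nonneg (hM.gap_nonneg hθ) hi] at he
  unfold Sbar
  refine integral_congr_ae ?_
  filter_upwards [he] with z hz
  have hu : M.centredRatio μ θ θ' z = 0 := by
    by_contra hne
    have := Real.add_one_lt_exp hne
    have := mul_pos (hM.p_pos hθ z) (sub_pos.2 this)
    simp only [Pi.zero_apply] at hz
    linarith
  have := hM.p_mul_exp_centredRatio (θ' := θ') hθ z
  rw [hu, h3, Real.exp_zero, mul_one, mul_one, ← hf] at this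
  rw [this, p]

theorem M2.T_mem (hM : M.M2 μ θhat) {θ : EuclideanSpace ℝ (Fin l)} (hθ : θ ∈ M.Θ) :
    M.T μ θhat θ ∈ M.Θ := hM.θhat_mem _ (hM.Sbar_mem θ hθ)

theorem M2.continuousOn_T (hM : M.M2 μ θhat) : ContinuousOn (M.T μ θhat) M.Θ :=
  hM.continuousOn_θhat.comp hM.continuousOn_Sbar hM.Sbar_mem

/-- EM increases the likelihood. -/
theorem M2.f_le_f_T (hM : M.M2 μ θhat) {θ : EuclideanSpace ℝ (Fin l)} (hθ : θ ∈ M.Θ) :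
    M.f μ θ ≤ M.f μ (M.T μ θhat θ) := by
  refine le_trans ?_ (hM.mul_exp_le_f hθ (hM.T_mem hθ))
  refine le_mul_of_one_le_right (hM.f_pos θ hθ).le (Real.one_le_exp (sub_nonneg.2 ?_))
  exact hM.θhat_max _ (hM.Sbar_mem θ hθ) θ hθ

/-- The two points have the same E-step, so the M-step sends both to `T θ`. It is `T θ`, not `θ`,
that is shown to be fixed. -/
theorem M2.T_mem_stationarySet (hM : M.M2 μ θhat) {θ : EuclideanSpace ℝ (Fin l)} (hθ : θ ∈ M.Θ)
    (h : M.f μ (M.T μ θhat θ) = M.f μ θ) : M.T μ θhat θ ∈ M.stationarySet μ θhat :=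
  ⟨hM.T_mem hθ, congrArg θhat (hM.Sbar_eq_of_f_eq hθ (hM.T_mem hθ)
    (hM.θhat_max _ (hM.Sbar_mem θ hθ) θ hθ) h)⟩

/-- At a fixed point the minorant touches `f` from below and has derivative zero, because the point
maximises `L`. No differentiation under the integral is involved. -/
theorem M2.stationarySet_subset_criticalSet (hM : M.M2 μ θhat) (hs : M.Smooth μ) :
    M.stationarySet μ θhat ⊆ M.criticalSet μ := by
  rintro θ ⟨hθ, hfix⟩
  refine ⟨hθ, ?_⟩
  have hnhds := hs.isOpen_Θ.mem_nhds hθ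
  have hmax : IsLocalMax (M.L (M.Sbar μ θ)) θ := by
    filter_upwards [hnhds] with θ' hθ'
    have := hM.θhat_max _ (hM.Sbar_mem θ hθ) θ' hθ'
    rwa [show θhat (M.Sbar μ θ) = θ from hfix] at this
  have hdL : DifferentiableAt ℝ (M.L (M.Sbar μ θ)) θ := by
    unfold L
    exact (hs.differentiableOn_ψ.differentiableAt hnhds).add
      ((differentiableAt_const _).inner ℝ (hs.differentiableOn_φ.differentiableAt hnhds))
  have hL : HasFDerivAt (M.L (M.Sbar μ θ)) 0 θ := hmax.fderiv_eq_zero ▸ hdL.hasFDerivAt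
  have hE : HasFDerivAt (fun θ' => M.f μ θ *
      Real.exp (M.L (M.Sbar μ θ) θ' - M.L (M.Sbar μ θ) θ))
      (0 : EuclideanSpace ℝ (Fin l) →L[ℝ] ℝ) θ := by
    simpa using ((hL.sub_const (M.L (M.Sbar μ θ) θ)).exp).const_mul (M.f μ θ)
  have hf := (hs.differentiableOn_f.differentiableAt hnhds).hasFDerivAt
  have hmin : IsLocalMin (fun θ' => M.f μ θ' - M.f μ θ *
      Real.exp (M.L (M.Sbar μ θ) θ' - M.L (M.Sbar μ θ) θ)) θ := by
    filter_upwards [hnhds] with θ' hθ'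
    simpa using hM.mul_exp_le_f hθ hθ'
  have h0 := hmin.hasFDerivAt_eq_zero (hf.sub hE)
  rw [sub_zero] at h0
  rw [hasGradientAt_iff_hasFDerivAt, map_zero, ← h0]
  exact hf

end Jensen

end CurvedExpFamily

/-! ### Uniform convergence of the approximate EM maps. -/

/-- Post-composition with a continuous map preserves uniform convergence to a map with relatively
compact range. -/
theorem TendstoUniformlyOn.comp_continuousOn_of_isCompact {ι α β γ : Type*} [UniformSpace β]
    [UniformSpace γ] {l : Filter ι} {G : ι → α → β} {G₀ : α → β} {C : Set α} {A D : Set β}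
    {g : β → γ} (hG : TendstoUniformlyOn G G₀ l C) (hA : IsCompact A) (hAD : A ⊆ D)
    (hG₀ : MapsTo G₀ C A) (hGD : ∀ n, MapsTo (G n) C D) (hg : ContinuousOn g D) :
    TendstoUniformlyOn (fun n x => g (G n x)) (fun x => g (G₀ x)) l C := by
  intro r hr
  have hA' : IsCompact ((↑) ⁻¹' A : Set D) :=
    IsInducing.subtypeVal.isCompact_preimage_iff (by simpa using hAD) |>.2 hA
  -- Only one of the two points compared has to lie in the compact set; `G n x` may be anywhere in
  -- `D`.
  have h := hA'.uniformContinuousAt_of_continuousAt (D.domRestrict g)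
    (fun a _ => (continuousOn_iff_continuous_domRestrict.1 hg).continuousAt) hr
  rw [uniformity_subtype, mem_comap] at h
  obtain ⟨t, ht, hts⟩ := h
  filter_upwards [hG t ht] with n hn x hx
  exact hts (a := (⟨G₀ x, hAD (hG₀ hx)⟩, ⟨G n x, hGD n hx⟩)) (hn x hx) (hG₀ hx)

theorem enorm_eq_ofReal_rpow_mul {x a b : ℝ} (ha : 0 ≤ a) (h : a * b = x ^ 2) :
    ‖x‖ₑ = ENNReal.ofReal a ^ (1 / 2 : ℝ) * ENNReal.ofReal b ^ (1 / 2 : ℝ) := by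
  rw [← ENNReal.mul_rpow_of_nonneg _ _ (by norm_num), ← ENNReal.ofReal_mul ha, h,
    ENNReal.ofReal_rpow_of_nonneg (sq_nonneg x) (by norm_num), ← Real.sqrt_eq_rpow,
    Real.sqrt_sq_eq_abs, ← Real.norm_eq_abs, ofReal_norm]

/-- The Cauchy–Schwarz inequality, for an integrand given through a factorization of its square. -/
theorem MeasureTheory.lintegral_enorm_le_rpow_mul_rpow {α : Type*} [MeasurableSpace α]
    {μ : Measure α} {g a b : α → ℝ} (ha : Measurable a) (hb : Measurable b) (ha0 : ∀ z, 0 ≤ a z)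
    (h : ∀ z, a z * b z = g z ^ 2) :
    ∫⁻ z, ‖g z‖ₑ ∂μ ≤ (∫⁻ z, ENNReal.ofReal (a z) ∂μ) ^ (1 / 2 : ℝ) *
      (∫⁻ z, ENNReal.ofReal (b z) ∂μ) ^ (1 / 2 : ℝ) := by
  simp_rw [fun z => enorm_eq_ofReal_rpow_mul (ha0 z) (h z)]
  exact ENNReal.lintegral_mul_norm_pow_le ha.ennreal_ofReal.aemeasurable
    hb.ennreal_ofReal.aemeasurable (by norm_num) (by norm_num) (by norm_num)

namespace CurvedExpFamily

section Approximation

variable {Z : Type*} [MeasurableSpace Z] {l q : ℕ} {μ : Measure Z} {M : CurvedExpFamily Z l q}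
  {θhat : EuclideanSpace ℝ (Fin q) → EuclideanSpace ℝ (Fin l)}
  {ptilde : ℕ → EuclideanSpace ℝ (Fin l) → Z → ℝ}

theorem measurable_S_apply (u : Fin q) : Measurable (fun z => M.S z u) :=
  (EuclideanSpace.proj (𝕜 := ℝ) u).continuous.measurable.comp M.measurable_S

theorem edist_Stilde_Sbar_apply_le (hM : M.M2 μ θhat) (hE : M.WellDefinedEStep μ ptilde) (n : ℕ)
    {θ : EuclideanSpace ℝ (Fin l)} (hθ : θ ∈ M.Θ) (u : Fin q) :
    edist (M.Stilde μ (ptilde n θ) u) (M.Sbar μ θ u) ≤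
      ∫⁻ z, ‖M.S z u * (ptilde n θ z - M.p μ θ z)‖ₑ ∂μ := by
  have h1 := hE.integrable n θ hθ
  have h2 := hM.integrable_S θ hθ
  rw [edist_eq_enorm_sub]
  have key : M.Stilde μ (ptilde n θ) u - M.Sbar μ θ u =
      ∫ z, M.S z u * (ptilde n θ z - M.p μ θ z) ∂μ := by
    have h3 := (EuclideanSpace.proj (𝕜 := ℝ) u).integral_comp_comm (h1.sub h2)
    rw [integral_sub' h1 h2] at h3
    rw [← PiLp.sub_apply]
    refine Eq.trans h3.symm (integral_congr_ae (Eventually.of_forall fun z => ?_))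
    simp
    ring
  rw [key]
  exact enorm_integral_le_lintegral_enorm _

/-- Both configurations factor `(S_u (p̃ - p))²`: as `S_u² · (p̃ - p)²`, or as `(S_u² p) · ((p̃/p -
1)² p)`, where `p > 0`. One factor has bounded integral, the other tends to zero in integral,
uniformly on `C`. -/
theorem tendstoUniformlyOn_Stilde_apply (hM : M.M2 μ θhat) (hE : M.WellDefinedEStep μ ptilde)
    {C : Set (EuclideanSpace ℝ (Fin l))} (hC : C ⊆ M.Θ) (u : Fin q)
    (h : M.ApproxL2 μ ptilde C u ∨ M.ApproxChiSq μ ptilde C u) :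
    TendstoUniformlyOn (fun n θ => M.Stilde μ (ptilde n θ) u) (fun θ => M.Sbar μ θ u) atTop C := by
  suffices ∃ (A : ℝ≥0∞) (b : ℕ → ℝ≥0∞), A ≠ ∞ ∧ Tendsto b atTop (𝓝 0) ∧
      ∀ n, ∀ θ ∈ C, ∫⁻ z, ‖M.S z u * (ptilde n θ z - M.p μ θ z)‖ₑ ∂μ ≤
        A ^ (1 / 2 : ℝ) * b n ^ (1 / 2 : ℝ) by
    obtain ⟨A, b, hA, hb, hle⟩ := this
    have hlim : Tendsto (fun n => A ^ (1 / 2 : ℝ) * b n ^ (1 / 2 : ℝ)) atTop (𝓝 0) := by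
      have h1 := ((ENNReal.continuous_rpow_const (y := 1 / 2)).tendsto 0).comp hb
      rw [ENNReal.zero_rpow_of_pos (by norm_num)] at h1
      simpa using ENNReal.Tendsto.const_mul h1
        (Or.inr (ENNReal.rpow_ne_top_of_nonneg (by norm_num) hA))
    rw [EMetric.tendstoUniformlyOn_iff]
    intro ε hε
    filter_upwards [hlim.eventually (gt_mem_nhds hε)] with n hn θ hθ
    rw [edist_comm]
    exact ((edist_Stilde_Sbar_apply_le hM hE n (hC hθ) u).trans (hle n θ hθ)).trans_lt hn
  have hS := measurable_S_apply (M := M) u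
  rcases h with ⟨h1, h2⟩ | ⟨h1, h2⟩
  · refine ⟨_, _, h1.ne, h2, fun n θ hθ => ?_⟩
    refine (lintegral_enorm_le_rpow_mul_rpow (hS.pow_const 2)
      (((hE.measurable n θ (hC hθ)).sub (measurable_p θ)).pow_const 2) (fun z => sq_nonneg _)
      (fun z => (mul_pow _ _ 2).symm)).trans ?_
    gcongr
    exact le_iSup₂_of_le θ hθ le_rfl
  · refine ⟨_, _, h1.ne, h2, fun n θ hθ => ?_⟩
    have hp := hM.p_pos (hC hθ)
    have hpm := measurable_p (M := M) (μ := μ) θ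
    refine (lintegral_enorm_le_rpow_mul_rpow ((hS.pow_const 2).mul hpm)
      (((((hE.measurable n θ (hC hθ)).div hpm).sub_const 1).pow_const 2).mul hpm)
      (fun z => mul_nonneg (sq_nonneg _) (hp z).le) (fun z => ?_)).trans ?_
    · have := (hp z).ne'
      simp only [Pi.mul_apply, Pi.div_apply]
      field_simp
    · gcongr
      · exact le_iSup₂_of_le (f := fun θ (_ : θ ∈ C) =>
          ∫⁻ z, ENNReal.ofReal (M.S z u ^ 2 * M.p μ θ z) ∂μ) θ hθ le_rfl
      · exact le_iSup₂_of_le (f := fun θ (_ : θ ∈ C) =>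
          ∫⁻ z, ENNReal.ofReal ((ptilde n θ z / M.p μ θ z - 1) ^ 2 * M.p μ θ z) ∂μ) θ hθ le_rfl

/-- The approximate EM maps converge to the EM map, uniformly on compact sets. -/
theorem tendstoUniformlyOn_approxMap (hM : M.M2 μ θhat) (hE : M.WellDefinedEStep μ ptilde)
    {C : Set (EuclideanSpace ℝ (Fin l))} (hC : C ⊆ M.Θ) (hCc : IsCompact C)
    (h : ∀ u, M.ApproxL2 μ ptilde C u ∨ M.ApproxChiSq μ ptilde C u) :
    TendstoUniformlyOn (M.approxMap μ θhat ptilde) (M.T μ θhat) atTop C := by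
  have h1 : TendstoUniformlyOn (fun n θ => M.Stilde μ (ptilde n θ)) (M.Sbar μ) atTop C := by
    have h2 : TendstoUniformlyOn (fun n θ => (M.Stilde μ (ptilde n θ)).ofLp)
        (fun θ => (M.Sbar μ θ).ofLp) atTop C := by
      rw [Metric.tendstoUniformlyOn_iff]
      intro ε hε
      have h3 := fun u => Metric.tendstoUniformlyOn_iff.1
        (tendstoUniformlyOn_Stilde_apply hM hE hC u (h u)) ε hε
      filter_upwards [eventually_all.2 h3] with n hn θ hθ
      exact (dist_pi_lt_iff hε).2 fun u => hn u θ hθ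
    exact (PiLp.uniformContinuous_toLp 2 fun _ : Fin q => ℝ).comp_tendstoUniformlyOn h2
  exact h1.comp_continuousOn_of_isCompact (hCc.image_of_continuousOn (hM.continuousOn_Sbar.mono hC))
    (by rintro _ ⟨θ, hθ, rfl⟩; exact hM.Sbar_mem θ (hC hθ)) (mapsTo_image _ _)
    (fun n θ hθ => hE.mem n θ (hC hθ)) hM.continuousOn_θhat

end Approximation

end CurvedExpFamily

/-! ### Reinitialisations of the truncated iteration. -/

section StableIter

variable {E : Type*} {F : ℕ → E → E} {K : ℕ → Set E} {θ₀ : E} {θ : ℕ → E} {p : ℕ → ℕ}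

theorem stableIter_step (h : ∀ n, (θ n, p n) = stableIter F K θ₀ n) (n : ℕ) :
    (F n (θ n) ∈ K (p n) ∧ θ (n + 1) = F n (θ n) ∧ p (n + 1) = p n) ∨
      (θ (n + 1) = θ₀ ∧ p (n + 1) = p n + 1) := by
  have h1 := h (n + 1)
  simp only [stableIter, ← h n] at h1
  split_ifs at h1 with hc
  · exact Or.inl ⟨by simpa only [← h n] using hc, Prod.ext_iff.1 h1⟩
  · exact Or.inr (Prod.ext_iff.1 h1)

theorem stableIter_zero (h : ∀ n, (θ n, p n) = stableIter F K θ₀ n) : θ 0 = θ₀ ∧ p 0 = 0 :=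
  Prod.ext_iff.1 (h 0)

theorem stableIter_monotone (h : ∀ n, (θ n, p n) = stableIter F K θ₀ n) : Monotone p := by
  refine monotone_nat_of_le_succ fun n => ?_
  rcases stableIter_step h n with h1 | h1 <;> omega

theorem stableIter_mem (h : ∀ n, (θ n, p n) = stableIter F K θ₀ n) (hK : Monotone K)
    (h0 : θ₀ ∈ K 0) (n : ℕ) : θ n ∈ K (p n) := by
  induction n with
  | zero => rw [(stableIter_zero h).1]; exact hK (Nat.zero_le _) h0
  | succ n ih =>
    rcases stableIter_step h n with h1 | h1
    · rw [h1.2.1, h1.2.2]; exact h1.1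
    · rw [h1.1]; exact hK (Nat.zero_le _) h0

/-- A set containing the starting point, eventually invariant and absorbed by the truncation sets
allows only finitely many reinitialisations. -/
theorem stableIter_bddAbove (h : ∀ n, (θ n, p n) = stableIter F K θ₀ n) (hK : Monotone K)
    {D : Set E} {m N : ℕ} (h0 : θ₀ ∈ D) (hD : D ⊆ K m) (hF : ∀ n ≥ N, MapsTo (F n) D D) :
    BddAbove (range p) := by
  by_contra hb
  have hex : ∃ n, max m (p N) < p n := by
    by_contra! hle
    exact hb ⟨_, forall_mem_range.2 hle⟩
  classical
  -- The first time the counter exceeds both `m` and `p N`: it comes after `N`, is a restart at `θ₀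
  -- ∈ D`, and from then on the truncation set contains `D`.
  obtain ⟨n₁, hn₁, hmin⟩ : ∃ n₁, max m (p N) < p n₁ ∧ ∀ k < n₁, p k ≤ max m (p N) :=
    ⟨Nat.find hex, Nat.find_spec hex, fun k hk => not_lt.1 (Nat.find_min hex hk)⟩
  have hN : N < n₁ := by
    by_contra! hle
    have := stableIter_monotone h hle
    omega
  obtain ⟨k, rfl⟩ : ∃ k, n₁ = k + 1 := ⟨n₁ - 1, by omega⟩
  have hstart : θ (k + 1) = θ₀ := by
    have := hmin k (Nat.lt_succ_self k)
    rcases stableIter_step h k with h1 | h1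
    · omega
    · exact h1.1
  have hinv : ∀ j, θ (k + 1 + j) ∈ D ∧ p (k + 1 + j) = p (k + 1) := by
    intro j
    induction j with
    | zero => exact ⟨hstart ▸ h0, rfl⟩
    | succ j ih =>
      have hmem := hF (k + 1 + j) (by omega) ih.1
      rcases stableIter_step h (k + 1 + j) with h1 | h1
      · exact ⟨h1.2.1 ▸ hmem, h1.2.2.trans ih.2⟩
      -- A further restart is impossible, since the proposed point lies in `D ⊆ K m`.
      · have hc := h (k + 1 + j + 1)
        simp only [stableIter, ← h (k + 1 + j)] at hc
        rw [if_pos (hK (by omega) (hD hmem))] at hc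
        have := congrArg Prod.snd hc
        simp only at this
        omega
  refine hb ⟨p (k + 1), forall_mem_range.2 fun n => ?_⟩
  rw [← (hinv n).2]
  exact stableIter_monotone h (by omega)

end StableIter

/-! ### Limits of perturbed ascents in a compact set. -/

section Lyapunov

variable {E : Type*} [PseudoMetricSpace E] {T : E → E} {f : E → ℝ} {ℒ C : Set E} {θ : ℕ → E}

theorem IsCompact.exists_subseq_of_frequently (hC : IsCompact C) (hθ : ∀ n, θ n ∈ C)
    {P : ℕ → Prop} (hP : ∃ᶠ n in atTop, P n) :
    ∃ φ : ℕ → ℕ, ∃ y ∈ C, StrictMono φ ∧ (∀ k, P (φ k)) ∧ Tendsto (θ ∘ φ) atTop (𝓝 y) := by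
  obtain ⟨φ, hφ, hPφ⟩ := extraction_of_frequently_atTop hP
  obtain ⟨y, hy, χ, hχ, hlim⟩ := hC.tendsto_subseq fun k => hθ (φ k)
  exact ⟨φ ∘ χ, y, hy, hφ.comp hχ, fun k => hPφ _, hlim⟩

/-- A sequence that frequently exceeds `c` and frequently falls below `c` frequently crosses `c`
downwards. -/
theorem frequently_downcrossing {w : ℕ → ℝ} {c : ℝ} (h1 : ∃ᶠ n in atTop, w n < c)
    (h2 : ∃ᶠ n in atTop, c < w n) : ∃ᶠ n in atTop, c ≤ w n ∧ w (n + 1) ≤ c := by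
  by_contra hcon
  rw [not_frequently, eventually_atTop] at hcon
  obtain ⟨N, hN⟩ := hcon
  obtain ⟨n, hn, hcn⟩ := frequently_atTop.1 h2 N
  have hall : ∀ j, c < w (n + j) := by
    intro j
    induction j with
    | zero => exact hcn
    | succ j ih =>
      by_contra! hle
      exact hN (n + j) (by omega) ⟨ih.le, hle⟩
  obtain ⟨m, hm, hwm⟩ := frequently_atTop.1 h1 n
  obtain ⟨j, rfl⟩ := Nat.exists_eq_add_of_le hm
  exact (hall j).not_gt hwm

variable (hC : IsCompact C) (hCcl : IsClosed C) (hθ : ∀ n, θ n ∈ C)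
  (hstep : ∀ φ : ℕ → ℕ, StrictMono φ → ∀ y, Tendsto (θ ∘ φ) atTop (𝓝 y) →
    Tendsto (fun k => θ (φ k + 1)) atTop (𝓝 (T y)))
  (hf : ContinuousOn f C) (hmono : ∀ y ∈ C, f y ≤ f (T y))
  (hfix : ∀ y ∈ C, f (T y) = f y → T y ∈ ℒ)

include hC hCcl hθ hstep hf in
-- The dynamics enter the later arguments only through this extraction, which passes to the limit at
-- times `φ k` and `φ k + 1` together.
theorem exists_subseq_step {P : ℕ → Prop} (hP : ∃ᶠ n in atTop, P n) :
    ∃ φ : ℕ → ℕ, ∃ y ∈ C, StrictMono φ ∧ (∀ k, P (φ k)) ∧ T y ∈ closure (range θ) ∧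
      Tendsto (fun k => θ (φ k + 1)) atTop (𝓝 (T y)) ∧
      Tendsto (fun k => f (θ (φ k))) atTop (𝓝 (f y)) ∧
      Tendsto (fun k => f (θ (φ k + 1))) atTop (𝓝 (f (T y))) := by
  obtain ⟨φ, y, hy, hφ, hPφ, hlim⟩ := hC.exists_subseq_of_frequently hθ hP
  have hlim' := hstep φ hφ y hlim
  have hTy : T y ∈ C := hCcl.mem_of_tendsto hlim' (Eventually.of_forall fun _ => hθ _)
  refine ⟨φ, y, hy, hφ, hPφ,
    mem_closure_of_tendsto hlim' (Eventually.of_forall fun _ => mem_range_self _), hlim',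
    (hf y hy).tendsto.comp
      (tendsto_nhdsWithin_iff.2 ⟨hlim, Eventually.of_forall fun _ => hθ _⟩),
    (hf _ hTy).tendsto.comp
      (tendsto_nhdsWithin_iff.2 ⟨hlim', Eventually.of_forall fun _ => hθ _⟩)⟩

include hC hCcl hθ hstep hf hmono hfix in
theorem mem_image_of_downcrossing {c : ℝ}
    (h : ∃ᶠ n in atTop, c ≤ f (θ n) ∧ f (θ (n + 1)) ≤ c) :
    c ∈ f '' (ℒ ∩ closure (range θ)) := by
  obtain ⟨φ, y, hy, -, hP, hcl, -, h1, h2⟩ := exists_subseq_step hC hCcl hθ hstep hf h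
  have hcy : c ≤ f y := ge_of_tendsto' h1 fun k => (hP k).1
  have hcT : f (T y) ≤ c := le_of_tendsto' h2 fun k => (hP k).2
  have hle := hmono y hy
  exact ⟨T y, ⟨hfix y hy (by linarith), hcl⟩, by linarith⟩

include hC hCcl hθ hstep hf hfix in
theorem subseq_limit_of_tendsto {c : ℝ} (hc : Tendsto (fun n => f (θ n)) atTop (𝓝 c))
    {P : ℕ → Prop} (hP : ∃ᶠ n in atTop, P n) :
    ∃ φ : ℕ → ℕ, ∃ x ∈ {t ∈ ℒ | f t = c} ∩ closure (range θ), (∀ k, P (φ k)) ∧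
      Tendsto (fun k => θ (φ k + 1)) atTop (𝓝 x) := by
  obtain ⟨φ, y, hy, hφ, hP, hcl, hlim, h1, h2⟩ := exists_subseq_step hC hCcl hθ hstep hf hP
  have e1 : f y = c := tendsto_nhds_unique h1 (hc.comp hφ.tendsto_atTop)
  have e2 : f (T y) = c := tendsto_nhds_unique h2
    (hc.comp ((tendsto_add_atTop_nat 1).comp hφ.tendsto_atTop))
  exact ⟨φ, T y, ⟨⟨hfix y hy (e2.trans e1.symm), e2⟩, hcl⟩, hP, hlim⟩

include hC hCcl hθ hstep hf hfix in
-- Once the values converge, `f y = f (T y)` for every subsequential limit `y`. Nonemptiness is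
-- needed separately, as `Metric.infDist` to the empty set is zero.
theorem tendsto_infDist_of_tendsto {c : ℝ} (hc : Tendsto (fun n => f (θ n)) atTop (𝓝 c)) :
    ({t ∈ ℒ | f t = c} ∩ closure (range θ)).Nonempty ∧
      Tendsto (fun n => Metric.infDist (θ n) ({t ∈ ℒ | f t = c} ∩ closure (range θ)))
        atTop (𝓝 0) := by
  set A := {t ∈ ℒ | f t = c} ∩ closure (range θ)
  refine ⟨?_, ?_⟩
  · obtain ⟨-, x, hx, -⟩ := subseq_limit_of_tendsto hC hCcl hθ hstep hf hfix hc
      (P := fun _ => True) (Frequently.of_forall fun _ => trivial)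
    exact ⟨x, hx⟩
  -- The index is shifted because the limits known to lie in `ℒ` are the points `T y`, limits of
  -- successors.
  · rw [← tendsto_add_atTop_iff_nat 1, Metric.tendsto_atTop']
    by_contra! hcon
    obtain ⟨ε, hε, hcon⟩ := hcon
    have hfreq : ∃ᶠ n in atTop, ε ≤ Metric.infDist (θ (n + 1)) A := by
      rw [frequently_atTop]
      intro N
      obtain ⟨n, hn, h⟩ := hcon N
      rw [Real.dist_0_eq_abs, abs_of_nonneg Metric.infDist_nonneg] at h
      exact ⟨n, hn.le, h⟩
    obtain ⟨φ, x, hx, hP, hlim⟩ := subseq_limit_of_tendsto hC hCcl hθ hstep hf hfix hc hfreq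
    have := ge_of_tendsto' (((Metric.continuous_infDist_pt A).tendsto x).comp hlim) hP
    rw [Metric.infDist_zero_of_mem hx] at this
    exact hε.not_ge this

include hC hCcl hθ hstep hf hmono hfix in
/-- The alternative for the values along a perturbed ascent: they converge, or every value strictly
between their lower and upper limits is attained at an accumulation point in `ℒ`. -/
theorem tendsto_or_exists_Ioo_subset :
    (∃ c, Tendsto (fun n => f (θ n)) atTop (𝓝 c)) ∨
      ∃ a b : ℝ, a < b ∧ Ioo a b ⊆ f '' (ℒ ∩ closure (range θ)) ∧
        ∀ ε > 0, ∀ᶠ n in atTop, f (θ n) ∈ Ioo (a - ε) (b + ε) := by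
  have hcompact := hC.image_of_continuousOn hf
  have hmem : ∀ n, f (θ n) ∈ f '' C := fun n => mem_image_of_mem f (hθ n)
  have hle : IsBoundedUnder (· ≤ ·) atTop (fun n => f (θ n)) := by
    obtain ⟨B, hB⟩ := hcompact.bddAbove
    exact isBoundedUnder_of ⟨B, fun n => hB (hmem n)⟩
  have hge : IsBoundedUnder (· ≥ ·) atTop (fun n => f (θ n)) := by
    obtain ⟨B, hB⟩ := hcompact.bddBelow
    exact isBoundedUnder_of ⟨B, fun n => hB (hmem n)⟩
  rcases (liminf_le_limsup hle hge).eq_or_lt with heq | hlt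
  · exact Or.inl ⟨_, tendsto_of_liminf_eq_limsup heq rfl hle hge⟩
  · refine Or.inr ⟨_, _, hlt, fun c hc => ?_, fun ε hε => ?_⟩
    · exact mem_image_of_downcrossing hC hCcl hθ hstep hf hmono hfix (frequently_downcrossing
        (frequently_lt_of_liminf_lt hle.isCoboundedUnder_flip hc.1)
        (frequently_lt_of_lt_limsup hge.isCoboundedUnder_flip hc.2))
    · filter_upwards [eventually_lt_of_lt_liminf (sub_lt_self _ hε) hge,
        eventually_lt_of_limsup_lt (lt_add_of_pos_right _ hε) hle] with n h1 h2
      exact ⟨h1, h2⟩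

theorem infDist_Ioo_le {a b ε x : ℝ} (hab : a < b) (hε : 0 ≤ ε)
    (hx : x ∈ Ioo (a - ε) (b + ε)) : Metric.infDist x (Ioo a b) ≤ ε := by
  rw [← Metric.infDist_closure, closure_Ioo hab.ne]
  have h1 := hx.1
  have h2 := hx.2
  have key : ∀ y ∈ Icc a b, |x - y| ≤ ε → Metric.infDist x (Icc a b) ≤ ε := fun y hy h =>
    (Metric.infDist_le_dist_of_mem hy).trans h
  rcases lt_or_ge x a with h | h
  · exact key a (left_mem_Icc.2 hab.le) (abs_le.2 ⟨by linarith, by linarith⟩)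
  rcases lt_or_ge b x with h' | h'
  · exact key b (right_mem_Icc.2 hab.le) (abs_le.2 ⟨by linarith, by linarith⟩)
  · exact key x ⟨h, h'⟩ (by simpa using hε)

include hC hCcl hθ hstep hf hmono hfix in
-- If the values converge, the component of their limit serves; if they oscillate, the interval they
-- sweep is connected and so lies in one component.
theorem exists_tendsto_infDist_connectedComponentIn :
    ∃ x ∈ f '' (ℒ ∩ closure (range θ)),
      Tendsto (fun n => Metric.infDist (f (θ n))
        (connectedComponentIn (f '' (ℒ ∩ closure (range θ))) x)) atTop (𝓝 0) := by
  rcases tendsto_or_exists_Ioo_subset hC hCcl hθ hstep hf hmono hfix with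
    ⟨c, hc⟩ | ⟨a, b, hab, hsub, hev⟩
  · obtain ⟨⟨t, ⟨ht, htc⟩, hcl⟩, -⟩ := tendsto_infDist_of_tendsto hC hCcl hθ hstep hf hfix hc
    have hmem : c ∈ f '' (ℒ ∩ closure (range θ)) := ⟨t, ⟨ht, hcl⟩, htc⟩
    refine ⟨c, hmem, ?_⟩
    have := ((Metric.continuous_infDist_pt
      (connectedComponentIn (f '' (ℒ ∩ closure (range θ))) c)).tendsto c).comp hc
    rwa [Metric.infDist_zero_of_mem (mem_connectedComponentIn hmem)] at this
  · obtain ⟨c, hc⟩ := exists_between hab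
    refine ⟨c, hsub hc, ?_⟩
    have hsub' := isPreconnected_Ioo.subset_connectedComponentIn hc hsub
    rw [Metric.tendsto_nhds]
    intro ε hε
    filter_upwards [hev (ε / 2) (half_pos hε)] with n hn
    rw [Real.dist_0_eq_abs, abs_of_nonneg Metric.infDist_nonneg]
    have h1 := Metric.infDist_le_infDist_of_subset (x := f (θ n)) hsub' ⟨c, hc⟩
    have h2 := infDist_Ioo_le hab (half_pos hε).le hn
    linarith

include hC hCcl hθ hstep hf hmono hfix in
theorem exists_tendsto_of_interior_eq_empty
    (hint : interior (f '' (ℒ ∩ closure (range θ))) = ∅) :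
    ∃ c, Tendsto (fun n => f (θ n)) atTop (𝓝 c) := by
  rcases tendsto_or_exists_Ioo_subset hC hCcl hθ hstep hf hmono hfix with h | ⟨a, b, hab, hsub, -⟩
  · exact h
  · obtain ⟨c, hc⟩ := exists_between hab
    have := interior_maximal hsub isOpen_Ioo hc
    rw [hint] at this
    exact this.elim

end Lyapunov

/-! ### Invariant level sets and the conclusion. -/

namespace CurvedExpFamily

section Convergence

variable {Z : Type*} [MeasurableSpace Z] {l q : ℕ} {μ : Measure Z} {M : CurvedExpFamily Z l q}
  {θhat : EuclideanSpace ℝ (Fin q) → EuclideanSpace ℝ (Fin l)}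
  {ℒ : Set (EuclideanSpace ℝ (Fin l))}
  {F : ℕ → EuclideanSpace ℝ (Fin l) → EuclideanSpace ℝ (Fin l)}

/-- Arbitrarily low positive values of the likelihood are missed by `ℒ`. -/
theorem M2.exists_level_notMem (hM : M.M2 μ θhat) (hℒ : ℒ ⊆ M.Θ) (hM3 : M.M3 μ ℒ) {a : ℝ}
    (ha : 0 < a) : ∃ c, 0 < c ∧ c ≤ a ∧ c ∉ M.f μ '' ℒ := by
  rcases hM3 with h | h
  · have h0 : (0 : ℝ) ∈ (M.f μ '' ℒ)ᶜ := by
      rintro ⟨t, ht, h0⟩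
      exact (hM.f_pos t (hℒ ht)).ne' h0
    obtain ⟨ε, hε, hb⟩ := Metric.isOpen_iff.1 h.isClosed.isOpen_compl 0 h0
    have hpos : 0 < min (ε / 2) a := lt_min (half_pos hε) ha
    refine ⟨min (ε / 2) a, hpos, min_le_right _ _, hb ?_⟩
    rw [Metric.mem_ball, Real.dist_0_eq_abs, abs_of_pos hpos]
    exact (min_le_left _ _).trans_lt (half_lt_self hε)
  -- Only levels in `(a/2, a)` are tried, so the finitely many values on the compact set `{f ≥ a/2}`
  -- are the only ones to avoid.
  · have hfin := h {t ∈ M.Θ | a / 2 ≤ M.f μ t} (sep_subset _ _)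
      (hM.isCompact_level _ (half_pos ha))
    obtain ⟨c, hc, hcn⟩ := (Ioo_infinite (half_lt_self ha)).exists_notMem_finite hfin
    refine ⟨c, (half_pos ha).trans hc.1, hc.2.le, ?_⟩
    rintro ⟨t, ht, rfl⟩
    exact hcn ⟨t, ⟨ht, hℒ ht, hc.1.le⟩, rfl⟩

/-- A level set of the likelihood at a non-stationary level is eventually invariant under maps that
converge to the EM map uniformly on compact sets. -/
theorem M2.eventually_mapsTo_level (hM : M.M2 μ θhat) (hF : ∀ n, MapsTo (F n) M.Θ M.Θ)
    (hlim : ∀ C ⊆ M.Θ, IsCompact C → TendstoUniformlyOn F (M.T μ θhat) atTop C) {c : ℝ}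
    (hc : 0 < c) (hcs : c ∉ M.f μ '' M.stationarySet μ θhat) :
    ∀ᶠ n in atTop, MapsTo (F n) {t ∈ M.Θ | c ≤ M.f μ t} {t ∈ M.Θ | c ≤ M.f μ t} := by
  set D := {t ∈ M.Θ | c ≤ M.f μ t} with hDdef
  have hD : IsCompact D := hM.isCompact_level c hc
  have hDΘ : D ⊆ M.Θ := sep_subset _ _
  have hlt : ∀ t ∈ D, c < M.f μ (M.T μ θhat t) := by
    intro t ht
    have h1 := hM.f_le_f_T ht.1
    refine lt_of_le_of_ne (ht.2.trans h1) fun he => hcs ?_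
    exact ⟨_, hM.T_mem_stationarySet ht.1 (le_antisymm (he ▸ ht.2) h1), he.symm⟩
  rcases D.eq_empty_or_nonempty with he | hne
  · rw [he]
    exact Eventually.of_forall fun n => mapsTo_empty _ _
  -- The minimum of `f ∘ T` on `D` exceeds `c`; the excess is the error allowed to `f ∘ F n`.
  obtain ⟨x, hx, hmin⟩ := hD.exists_isMinOn hne
    (hM.continuousOn_f.comp (hM.continuousOn_T.mono hDΘ) fun t ht => hM.T_mem ht.1)
  have hu := (hlim D hDΘ hD).comp_continuousOn_of_isCompact
    (hD.image_of_continuousOn (hM.continuousOn_T.mono hDΘ))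
    (by rintro _ ⟨t, ht, rfl⟩; exact hM.T_mem ht.1) (mapsTo_image _ _)
    (fun n => (hF n).mono_left hDΘ) hM.continuousOn_f
  filter_upwards [Metric.tendstoUniformlyOn_iff.1 hu _ (sub_pos.2 (hlt x hx))] with n hn t ht
  refine ⟨hF n ht.1, ?_⟩
  have h1 := (abs_lt.1 (hn t ht)).2
  have h2 : M.f μ (M.T μ θhat x) ≤ M.f μ (M.T μ θhat t) := hmin ht
  linarith

end Convergence

end CurvedExpFamily

/-- Orbits of maps that converge uniformly on a compact set follow the limit map. -/
theorem TendstoUniformlyOn.tendsto_orbit_succ {E : Type*} [PseudoMetricSpace E] {F : ℕ → E → E}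
    {T : E → E} {C : Set E} {θ : ℕ → E} (hF : TendstoUniformlyOn F T atTop C) (hC : IsClosed C)
    (hT : ContinuousOn T C) (hθ : ∀ n, θ n ∈ C) (hrec : ∀ᶠ n in atTop, θ (n + 1) = F n (θ n))
    {φ : ℕ → ℕ} (hφ : StrictMono φ) {y : E} (hy : Tendsto (θ ∘ φ) atTop (𝓝 y)) :
    Tendsto (fun k => θ (φ k + 1)) atTop (𝓝 (T y)) := by
  have hyC : y ∈ C := hC.mem_of_tendsto hy (Eventually.of_forall fun _ => hθ _)
  have h1 : Tendsto (fun k => T (θ (φ k))) atTop (𝓝 (T y)) := (hT y hyC).tendsto.comp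
    (tendsto_nhdsWithin_iff.2 ⟨hy, Eventually.of_forall fun _ => hθ _⟩)
  refine h1.congr_dist (Metric.tendsto_nhds.2 fun ε hε => ?_)
  filter_upwards [hφ.tendsto_atTop.eventually (Metric.tendstoUniformlyOn_iff.1 hF ε hε),
    hφ.tendsto_atTop.eventually hrec] with k hk hr
  rw [hr, Real.dist_0_eq_abs, abs_of_nonneg dist_nonneg]
  exact hk _ (hθ _)

theorem mainTheorem1 {Z : Type*} [MeasurableSpace Z] {l q : ℕ}
    (μ : Measure Z) [SigmaFinite μ] (M : CurvedExpFamily Z l q)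
    (θhat : EuclideanSpace ℝ (Fin q) → EuclideanSpace ℝ (Fin l))
    (hM2 : M.M2 μ θhat)
    (ℒ : Set (EuclideanSpace ℝ (Fin l)))
    (hℒ : ℒ = M.stationarySet μ θhat ∨ (M.Smooth μ ∧ ℒ = M.criticalSet μ))
    (hM3 : M.M3 μ ℒ)
    (ptilde : ℕ → EuclideanSpace ℝ (Fin l) → Z → ℝ)
    (hE : M.WellDefinedEStep μ ptilde)
    (happrox : ∀ u : Fin q, ∀ K ⊆ M.Θ, IsCompact K →
      M.ApproxL2 μ ptilde K u ∨ M.ApproxChiSq μ ptilde K u)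
    (K : ℕ → Set (EuclideanSpace ℝ (Fin l))) (hK : IsTruncationSeq M.Θ K)
    (θ₀ : EuclideanSpace ℝ (Fin l)) (hθ₀ : θ₀ ∈ K 0)
    (θ : ℕ → EuclideanSpace ℝ (Fin l)) (p : ℕ → ℕ)
    (hθp : ∀ n, (θ n, p n) = stableIter (M.approxMap μ θhat ptilde) K θ₀ n) :
    -- finitely many reinitialisations, and the sequence stays in a compact set
    (BddAbove (range p) ∧ ∃ C ⊆ M.Θ, IsCompact C ∧ ∀ n, θ n ∈ C) ∧
    -- the likelihood values converge to a connected component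
    (∃ x ∈ M.f μ '' (ℒ ∩ closure (range θ)),
      Tendsto (fun n => Metric.infDist (M.f μ (θ n))
        (connectedComponentIn (M.f μ '' (ℒ ∩ closure (range θ))) x)) atTop (𝓝 0)) ∧
    -- convergence of the values and of the sequence when the image has empty interior
    (interior (M.f μ '' (ℒ ∩ closure (range θ))) = ∅ →
      ∃ fstar : ℝ, Tendsto (fun n => M.f μ (θ n)) atTop (𝓝 fstar) ∧
        ({t ∈ ℒ | M.f μ t = fstar} ∩ closure (range θ)).Nonempty ∧
        Tendsto (fun n => Metric.infDist (θ n)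
          ({t ∈ ℒ | M.f μ t = fstar} ∩ closure (range θ))) atTop (𝓝 0)) := by
  have hstat : M.stationarySet μ θhat ⊆ ℒ := by
    rcases hℒ with rfl | ⟨hs, rfl⟩
    · exact Subset.rfl
    · exact hM2.stationarySet_subset_criticalSet hs
  have hℒΘ : ℒ ⊆ M.Θ := by
    rcases hℒ with rfl | ⟨-, rfl⟩ <;> exact sep_subset _ _
  have hKΘ : ∀ n, K n ⊆ M.Θ := fun n => hK.iUnion_eq ▸ subset_iUnion K n
  have hlim : ∀ C ⊆ M.Θ, IsCompact C →
      TendstoUniformlyOn (M.approxMap μ θhat ptilde) (M.T μ θhat) atTop C := fun C hC hCc =>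
    CurvedExpFamily.tendstoUniformlyOn_approxMap hM2 hE hC hCc fun u => happrox u C hC hCc
  have hFΘ : ∀ n, MapsTo (M.approxMap μ θhat ptilde n) M.Θ M.Θ := fun n t ht =>
    hM2.θhat_mem _ (hE.mem n t ht)
  have hbdd : BddAbove (range p) := by
    obtain ⟨c, hc, hcle, hcn⟩ :=
      hM2.exists_level_notMem hℒΘ hM3 (hM2.f_pos θ₀ (hKΘ 0 hθ₀))
    obtain ⟨m, hm⟩ := hK.absorbs _ (sep_subset M.Θ fun t => c ≤ M.f μ t)
      (hM2.isCompact_level c hc)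
    obtain ⟨N, hN⟩ := eventually_atTop.1 (hM2.eventually_mapsTo_level hFΘ hlim hc
      fun h => hcn (image_mono hstat h))
    exact stableIter_bddAbove (D := {t ∈ M.Θ | c ≤ M.f μ t}) hθp hK.mono ⟨hKΘ 0 hθ₀, hcle⟩ hm hN
  -- The counter attains its maximum at `N`: no restart follows, and `K (p N)` contains the whole
  -- sequence.
  obtain ⟨N, hN⟩ : sSup (range p) ∈ range p := Nat.sSup_mem (range_nonempty p) hbdd
  have hpN : ∀ n, p n ≤ p N := fun n => hN ▸ le_csSup hbdd (mem_range_self n)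
  have hCc : IsCompact (K (p N)) := hK.isCompact _
  have hθC : ∀ n, θ n ∈ K (p N) := fun n => hK.mono (hpN n) (stableIter_mem hθp hK.mono hθ₀ n)
  have hrec : ∀ᶠ n in atTop, θ (n + 1) = M.approxMap μ θhat ptilde n (θ n) := by
    filter_upwards [eventually_ge_atTop N] with n hn
    rcases stableIter_step hθp n with h | h
    · exact h.2.1
    · have := hpN (n + 1)
      have := stableIter_monotone hθp hn
      omega
  have hstep : ∀ φ : ℕ → ℕ, StrictMono φ → ∀ y, Tendsto (θ ∘ φ) atTop (𝓝 y) →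
      Tendsto (fun k => θ (φ k + 1)) atTop (𝓝 (M.T μ θhat y)) := fun φ hφ y hy =>
    (hlim _ (hKΘ _) hCc).tendsto_orbit_succ hCc.isClosed (hM2.continuousOn_T.mono (hKΘ _)) hθC
      hrec hφ hy
  have hf := hM2.continuousOn_f.mono (hKΘ (p N))
  have hmono : ∀ y ∈ K (p N), M.f μ y ≤ M.f μ (M.T μ θhat y) := fun y hy =>
    hM2.f_le_f_T (hKΘ _ hy)
  have hfix : ∀ y ∈ K (p N), M.f μ (M.T μ θhat y) = M.f μ y → M.T μ θhat y ∈ ℒ :=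
    fun y hy h => hstat (hM2.T_mem_stationarySet (hKΘ _ hy) h)
  refine ⟨⟨hbdd, _, hKΘ _, hCc, hθC⟩, exists_tendsto_infDist_connectedComponentIn hCc
    hCc.isClosed hθC hstep hf hmono hfix, fun hint => ?_⟩
  obtain ⟨c, hc⟩ := exists_tendsto_of_interior_eq_empty hCc hCc.isClosed hθC hstep hf hmono hfix
    hint
  exact ⟨c, hc, tendsto_infDist_of_tendsto hCc hCc.isClosed hθC hstep hf hfix hc⟩
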